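/- Let $q\in[0,1]$, put $[k]_q=1+q+\cdots+q^{k-1}$ and $[n]_q!=[1]_q[2]_q\cdots[n]_q$ (with $[0]_q!=1$), and let $$E_q(t)=\sum_{n=0}^\infty \frac{t^n}{[n]_q!},\qquad (1-q)|t|<1 .$$ Let $\mathbf H_{2,q}$ be the reproducing kernel Hilbert space of functions on the disk $\{z\in\mathbb C:(1-q)|z|^2<1\}$ (all of $\mathbb C$ if $q=1$) with reproducing kernel $E_q(z\overline w)$. Then $\mathbf H_{2,q}$ is a de Branges–Rovnyak space. That is, there is a Schur function $b$, i.e. a function analytic in the open unit disk $\mathbb D$ whose values are contractions from a coefficient Hilbert space to $\mathbb C$ (one can take the coefficient space $\ell^2(\mathbb N,\mathbb C)$), such that $$E_q(z\overline w)=\frac{1-b(z)b(w)^*}{1-z\overline w},\qquad z,w\in\mathbb D,$$ and the restriction map $f\mapsto f|_{\mathbb D}$ is a unitary map from $\mathbf H_{2,q}$ onto the de Branges–Rovnyak space $\mathcal H(b)$, the reproducing kernel Hilbert space of functions on $\mathbb D$ with kernel $\frac{1-b(z)b(w)^*}{1-z\overline w}$. -/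

import Mathlib

open scoped ComplexConjugate lp

noncomputable section

namespace QFock

/-- The `q`-integer `[k]_q = 1 + q + ⋯ + q^(k-1)`. -/
def qInt (q : ℝ) (k : ℕ) : ℝ := ∑ i ∈ Finset.range k, q ^ i

/-- The `q`-factorial `[n]_q! = [1]_q [2]_q ⋯ [n]_q`, with `[0]_q! = 1`. -/
def qFactorial (q : ℝ) (n : ℕ) : ℝ := ∏ j ∈ Finset.range n, qInt q (j + 1)

/-- The `q`-exponential `E_q(t) = ∑ t^n / [n]_q!`; for `0 ≤ q ≤ 1` the series converges
absolutely when `(1 - q) |t| < 1`, see `summable_qExp`. -/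
def qExp (q : ℝ) (t : ℂ) : ℂ := ∑' n : ℕ, t ^ n / (qFactorial q n : ℂ)

/-- The disk `|z|^2 < 1 / (1 - q)` on which `E_q (z * conj w)` is defined; it is the whole
plane for `q = 1`. -/
def qDisk (q : ℝ) : Set ℂ := {z | (1 - q) * ‖z‖ ^ 2 < 1}

/-- The kernel `K_q(z, w) = E_q(z * conj w)`, a number being seen as an operator on `ℂ`. -/
def qKernel (q : ℝ) : Matrix (qDisk q) (qDisk q) (ℂ →L[ℂ] ℂ) :=
  .of fun z w ↦ qExp q ((z : ℂ) * conj (w : ℂ)) • ContinuousLinearMap.id ℂ ℂ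

theorem one_le_qInt {q : ℝ} (hq : 0 ≤ q) (k : ℕ) : 1 ≤ qInt q (k + 1) := by
  rw [qInt, Finset.sum_range_succ']
  simp only [pow_zero, le_add_iff_nonneg_left]
  positivity

theorem qFactorial_pos {q : ℝ} (hq : 0 ≤ q) (n : ℕ) : 0 < qFactorial q n :=
  Finset.prod_pos fun j _ ↦ lt_of_lt_of_le one_pos (one_le_qInt hq j)

theorem summable_norm_qExp {q : ℝ} (h0 : 0 ≤ q) (h1 : q ≤ 1) {t : ℝ} (ht : 0 ≤ t)
    (hqt : (1 - q) * t < 1) : Summable fun n : ℕ ↦ t ^ n / qFactorial q n := by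
  obtain ⟨k, hk⟩ : ∃ k : ℕ, t < qInt q (k + 1) := by
    rcases h1.eq_or_lt with rfl | h1
    · obtain ⟨k, hk⟩ := exists_nat_gt t
      exact ⟨k, by simp [qInt]; linarith⟩
    · have h2 : 0 < 1 - q := by linarith
      obtain ⟨k, hk⟩ := exists_pow_lt_of_lt_one (show 0 < 1 - (1 - q) * t by linarith) h1
      refine ⟨k, ?_⟩
      have h3 : (1 - q) * qInt q (k + 1) = 1 - q ^ (k + 1) := by
        rw [qInt]; exact mul_neg_geom_sum q (k + 1)
      have h4 : q ^ (k + 1) ≤ q ^ k := pow_le_pow_of_le_one h0 h1.le (Nat.le_succ k)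
      nlinarith
  have hk0 : 0 < qInt q (k + 1) := lt_of_le_of_lt ht hk
  refine summable_of_ratio_norm_eventually_le (r := t / qInt q (k + 1))
    ((div_lt_one hk0).2 hk) ?_
  filter_upwards [Filter.eventually_ge_atTop k] with n hn
  have hp := qFactorial_pos h0 n
  have hmono : qInt q (k + 1) ≤ qInt q (n + 1) :=
    Finset.sum_le_sum_of_subset_of_nonneg (Finset.range_mono (by omega))
      fun i _ _ ↦ pow_nonneg h0 i
  have hn0 : 0 < qInt q (n + 1) := lt_of_lt_of_le hk0 hmono
  rw [qFactorial, Finset.prod_range_succ, ← qFactorial, Real.norm_of_nonneg (by positivity),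
    Real.norm_of_nonneg (by positivity), pow_succ, mul_comm (qFactorial q n), mul_comm (t ^ n),
    mul_div_mul_comm]
  gcongr

theorem summable_qExp {q : ℝ} (h0 : 0 ≤ q) (h1 : q ≤ 1) {t : ℂ} (ht : (1 - q) * ‖t‖ < 1) :
    Summable fun n : ℕ ↦ t ^ n / (qFactorial q n : ℂ) := by
  refine Summable.of_norm ((summable_norm_qExp h0 h1 (norm_nonneg t) ht).congr fun n ↦ ?_)
  rw [norm_div, norm_pow, Complex.norm_real, Real.norm_of_nonneg (qFactorial_pos h0 n).le]

/-- The sequence `conj z ^ n / √[n]_q!`, a feature vector of the kernel `K_q`. -/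
def featureVec {q : ℝ} (h0 : 0 ≤ q) (h1 : q ≤ 1) (z : qDisk q) : ℓ²(ℕ, ℂ) :=
  ⟨fun n ↦ conj (z : ℂ) ^ n / (√(qFactorial q n) : ℂ), by
    refine memℓp_gen ((summable_norm_qExp h0 h1 (sq_nonneg ‖(z : ℂ)‖) z.2).congr fun n ↦ ?_)
    have := qFactorial_pos h0 n
    simp only [ENNReal.toReal_ofNat, Real.rpow_ofNat, norm_div, norm_pow, RCLike.norm_conj,
      Complex.norm_real, Real.norm_eq_abs, div_pow, sq_abs, Real.sq_sqrt this.le]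
    ring⟩

theorem inner_featureVec {q : ℝ} (h0 : 0 ≤ q) (h1 : q ≤ 1) (z w : qDisk q) :
    inner ℂ (featureVec h0 h1 z) (featureVec h0 h1 w) = qExp q ((z : ℂ) * conj (w : ℂ)) := by
  rw [lp.inner_eq_tsum, qExp]
  refine tsum_congr fun n ↦ ?_
  have h : (√(qFactorial q n) : ℂ) * (√(qFactorial q n) : ℂ) = (qFactorial q n : ℂ) := by
    rw [← Complex.ofReal_mul, Real.mul_self_sqrt (qFactorial_pos h0 n).le]
  simp only [featureVec, RCLike.inner_apply, map_div₀, map_pow, Complex.conj_conj,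
    Complex.conj_ofReal]
  rw [div_mul_div_comm, h, mul_pow, mul_comm]

theorem posSemidef_qKernel {q : ℝ} (h0 : 0 ≤ q) (h1 : q ≤ 1) : (qKernel q).PosSemidef := by
  have key := (RKHS.posSemidef_tfae (K := qKernel q)).out 0 2
  refine key.2 ⟨?_, fun v ↦ ?_⟩
  · refine Matrix.IsHermitian.ext fun z w ↦ ?_
    simp only [qKernel, Matrix.of_apply, ← ContinuousLinearMap.one_def, star_smul, star_one,
      ← inner_featureVec h0 h1]
    rw [← inner_conj_symm]
    simp
  · have : (v.sum fun x a ↦ v.sum fun y c ↦ inner ℂ (qKernel q y x a) c) =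
        inner ℂ (v.sum fun x a ↦ a • featureVec h0 h1 x)
          (v.sum fun x a ↦ a • featureVec h0 h1 x) := by
      simp only [Finsupp.sum, sum_inner, inner_sum]
      rw [Finset.sum_comm]
      refine Finset.sum_congr rfl fun x _ ↦ Finset.sum_congr rfl fun y _ ↦ ?_
      simp only [qKernel, Matrix.of_apply, ← inner_featureVec h0 h1, inner_smul_left,
        inner_smul_right, smul_apply, ContinuousLinearMap.id_apply,
        smul_eq_mul, RCLike.inner_apply, map_mul, inner_conj_symm]
      ring
    rw [this]
    exact inner_self_nonneg

instance (q : unitInterval) : Fact (qKernel q).PosSemidef := ⟨posSemidef_qKernel q.2.1 q.2.2⟩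

/-- The `q`-Fock space `H_{2,q}`, `0 ≤ q ≤ 1`: the reproducing kernel Hilbert space of functions
on `qDisk q` with reproducing kernel `E_q(z * conj w)`. -/
abbrev H2 (q : unitInterval) : Type := RKHS.OfKernel (qKernel q)

theorem kernel_H2 (q : unitInterval) (z w : qDisk q) :
    RKHS.kernel (H2 q) z w 1 = qExp q ((z : ℂ) * conj (w : ℂ)) := by
  rw [RKHS.OfKernel.kernel_ofKernel]
  simp [qKernel]

theorem ball_subset_qDisk (q : unitInterval) : Metric.ball (0 : ℂ) 1 ⊆ qDisk q := by
  intro z hz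
  have hz' : ‖z‖ < 1 := by simpa using hz
  have h0 := q.2.1
  have h1 := q.2.2
  have h2 : ‖z‖ ^ 2 < 1 := by nlinarith [norm_nonneg z]
  change (1 - (q : ℝ)) * ‖z‖ ^ 2 < 1
  nlinarith [sq_nonneg ‖z‖]

section DeBrangesRovnyak

variable {E F : Type*} [NormedAddCommGroup E] [InnerProductSpace ℂ E]
  [NormedAddCommGroup F] [InnerProductSpace ℂ F]

/-- An operator-valued Schur function: analytic in the open unit disk, with contractive values. -/
structure IsSchurFunction (b : ℂ → E →L[ℂ] F) : Prop where
  differentiableOn : DifferentiableOn ℂ b (Metric.ball 0 1)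
  norm_le_one : ∀ z ∈ Metric.ball (0 : ℂ) 1, ‖b z‖ ≤ 1

/-- The kernel `(1 - b(z) b(w)^*) / (1 - z * conj w)`. -/
def dBRKernel [CompleteSpace E] [CompleteSpace F] (b : ℂ → E →L[ℂ] F) (z w : ℂ) : F →L[ℂ] F :=
  (1 - z * conj w)⁻¹ • (ContinuousLinearMap.id ℂ F - b z ∘L (b w).adjoint)

/-- `H` is the de Branges–Rovnyak space `H(b)`: a Hilbert space of functions on the open unit disk
with reproducing kernel `(1 - b(z) b(w)^*) / (1 - z * conj w)`, where `b` is a Schur function. -/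
structure IsDeBrangesRovnyakSpace [CompleteSpace E] [CompleteSpace F] (b : ℂ → E →L[ℂ] F)
    (H : Type*) [NormedAddCommGroup H] [InnerProductSpace ℂ H] [CompleteSpace H]
    [RKHS ℂ H (Metric.ball (0 : ℂ) 1) F] : Prop where
  isSchurFunction : IsSchurFunction b
  kernel_eq : ∀ z w : Metric.ball (0 : ℂ) 1, RKHS.kernel H z w = dBRKernel b z w

end DeBrangesRovnyak

end QFock

end

/-!
The identity behind the theorem is
`1 - (1 - t) E_q(t) = ∑ c_n t ^ (n + 1)`, `c_n = 1 / [n]_q! - 1 / [n+1]_q!`, for `|t| < 1`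
(`hasSum_schurCoeff`). Since `[n+1]_q ≥ 1`, the `q`-factorials increase and all `c_n` are
nonnegative, so with `t = z * conj w` the right-hand side is `b(z) b(w)^*` for the row
`b(z) = (√c_n z ^ (n + 1))_n`. Dividing by `1 - z * conj w` gives the kernel identity
(`dBRKernel_schurFun`). On the diagonal the identity reads
`‖b(z)‖² = 1 - (1 - |z|²) E_q(|z|²) ≤ 1`, so `b` is contractive, and it is analytic as a locally
uniformly convergent power series with values in the dual of `ℓ²` (`isSchurFunction_schurFun`).

For the restriction map, the disk of definition of `H_{2,q}` contains the unit disk and is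
connected. Kernel functions are analytic there, their span is dense, and norm convergence implies
locally uniform convergence, so every function in `H_{2,q}` is analytic
(`differentiableOn_extendZero`). By the identity theorem restriction to the unit disk is injective
(`eq_zero_of_eqOn_ball`). Hence the Hilbert space `H_{2,q}` itself, viewed through restriction, is
a reproducing kernel Hilbert space on the unit disk (`restrictBall`), whose kernel is the restricted
kernel, that is, the kernel of `H(b)`. As a reproducing kernel Hilbert space is determined by its
kernel, this space is `H(b)`.
-/

namespace QFock

/-! ### Analyticity of the `q`-exponential -/

theorem norm_pow_div_qFactorial {q : ℝ} (h0 : 0 ≤ q) (t : ℂ) (n : ℕ) :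
    ‖t ^ n / (qFactorial q n : ℂ)‖ = ‖t‖ ^ n / qFactorial q n := by
  rw [norm_div, norm_pow, Complex.norm_real, Real.norm_of_nonneg (qFactorial_pos h0 n).le]

theorem differentiableAt_qExp {q : ℝ} (h0 : 0 ≤ q) (h1 : q ≤ 1) {t : ℂ}
    (ht : (1 - q) * ‖t‖ < 1) : DifferentiableAt ℂ (qExp q) t := by
  obtain ⟨r, hr, hr'⟩ : ∃ r : ℝ, (1 - q) * r < 1 ∧ ‖t‖ < r := by
    have hev : ∀ᶠ r in nhdsWithin ‖t‖ (Set.Ioi ‖t‖), (1 - q) * r < 1 :=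
      ((continuous_const.mul continuous_id).continuousAt.eventually_lt
        continuousAt_const ht).filter_mono nhdsWithin_le_nhds
    exact (hev.and self_mem_nhdsWithin).exists
  have hr0 : 0 ≤ r := (norm_nonneg t).trans hr'.le
  have hd : DifferentiableOn ℂ (qExp q) (Metric.ball 0 r) := by
    refine Complex.differentiableOn_tsum_of_summable_norm (summable_norm_qExp h0 h1 hr0 hr)
      (fun n ↦ by fun_prop) Metric.isOpen_ball fun n w hw ↦ ?_
    rw [norm_pow_div_qFactorial h0]
    have hw' : ‖w‖ ≤ r := by simpa using (mem_ball_zero_iff.1 hw).le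
    have := qFactorial_pos h0 n
    gcongr
  exact hd.differentiableAt (Metric.isOpen_ball.mem_nhds (by simpa using hr'))

/-! ### The Schur function -/

/-- The coefficient `1 / [n]_q! - 1 / [n+1]_q!` of `t ^ (n + 1)` in `1 - (1 - t) E_q(t)`. -/
noncomputable def schurCoeff (q : ℝ) (n : ℕ) : ℝ := (qFactorial q n)⁻¹ - (qFactorial q (n + 1))⁻¹

theorem one_le_qFactorial {q : ℝ} (h0 : 0 ≤ q) (n : ℕ) : 1 ≤ qFactorial q n :=
  Finset.prod_induction _ (1 ≤ ·) (fun _ _ ↦ one_le_mul_of_one_le_of_one_le) le_rfl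
    fun j _ ↦ one_le_qInt h0 j

theorem schurCoeff_nonneg {q : ℝ} (h0 : 0 ≤ q) (n : ℕ) : 0 ≤ schurCoeff q n := by
  have h := qFactorial_pos h0 n
  rw [schurCoeff, sub_nonneg]
  refine inv_anti₀ h ?_
  rw [qFactorial, qFactorial, Finset.prod_range_succ, ← qFactorial]
  exact le_mul_of_one_le_right h.le (one_le_qInt h0 n)

theorem schurCoeff_le_one {q : ℝ} (h0 : 0 ≤ q) (n : ℕ) : schurCoeff q n ≤ 1 := by
  have h := inv_le_one_of_one_le₀ (one_le_qFactorial h0 n)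
  have h' := inv_pos.2 (qFactorial_pos h0 (n + 1))
  rw [schurCoeff]
  linarith

/-- With `t = z * conj w`, the series is the expansion of `b(z) b(w)^*`. -/
theorem hasSum_schurCoeff {q : ℝ} (h0 : 0 ≤ q) (h1 : q ≤ 1) {t : ℂ} (ht : ‖t‖ < 1) :
    HasSum (fun n ↦ (schurCoeff q n : ℂ) * t ^ (n + 1)) (1 - (1 - t) * qExp q t) := by
  have hE : HasSum (fun n ↦ t ^ n / (qFactorial q n : ℂ)) (qExp q t) :=
    (summable_qExp h0 h1 (by nlinarith [norm_nonneg t])).hasSum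
  have hshift : HasSum (fun n ↦ t ^ (n + 1) / (qFactorial q (n + 1) : ℂ)) (qExp q t - 1) := by
    simpa [qFactorial] using (hasSum_nat_add_iff' 1).2 hE
  have h := (hE.mul_left t).sub hshift
  rw [show t * qExp q t - (qExp q t - 1) = 1 - (1 - t) * qExp q t by ring] at h
  refine Eq.subst (motive := (HasSum · _)) (funext fun n ↦ ?_) h
  rw [schurCoeff]
  push_cast
  ring

/-- For `z` in the unit disk, the vector with coordinates `√(schurCoeff q n) * conj z ^ (n + 1)`,
which represents the functional `b(z)`; outside the disk, where the sequence need not be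
square summable, it is set to `0`. -/
noncomputable def schurVec (q : unitInterval) (z : ℂ) : ℓ²(ℕ, ℂ) :=
  if hz : ‖z‖ < 1 then
    ⟨fun n ↦ (√(schurCoeff q n) : ℂ) * conj z ^ (n + 1), by
      have hz2 : ‖((‖z‖ ^ 2 : ℝ) : ℂ)‖ < 1 := by
        rw [Complex.norm_real, Real.norm_of_nonneg (by positivity)]
        exact pow_lt_one₀ (norm_nonneg z) hz two_ne_zero
      refine memℓp_gen ((hasSum_schurCoeff q.2.1 q.2.2 hz2).summable.norm.congr fun n ↦ ?_)
      have := schurCoeff_nonneg q.2.1 n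
      simp only [ENNReal.toReal_ofNat, Real.rpow_ofNat, norm_mul, norm_pow, RCLike.norm_conj,
        Complex.norm_real, Real.norm_eq_abs, mul_pow, sq_abs, Real.sq_sqrt this, abs_of_nonneg this,
        abs_norm]
      ring⟩
  else 0

theorem schurVec_apply (q : unitInterval) {z : ℂ} (hz : ‖z‖ < 1) (n : ℕ) :
    schurVec q z n = (√(schurCoeff q n) : ℂ) * conj z ^ (n + 1) := by
  rw [schurVec, dif_pos hz]

theorem inner_schurVec (q : unitInterval) {z w : ℂ} (hz : ‖z‖ < 1) (hw : ‖w‖ < 1) :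
    inner ℂ (schurVec q z) (schurVec q w) =
      1 - (1 - z * conj w) * qExp q (z * conj w) := by
  have ht : ‖z * conj w‖ < 1 := by
    rw [norm_mul, RCLike.norm_conj]
    exact mul_lt_one_of_nonneg_of_lt_one_left (norm_nonneg z) hz hw.le
  rw [lp.inner_eq_tsum, ← (hasSum_schurCoeff q.2.1 q.2.2 ht).tsum_eq]
  refine tsum_congr fun n ↦ ?_
  have h : (√(schurCoeff q n) : ℂ) * (√(schurCoeff q n) : ℂ) = (schurCoeff q n : ℂ) := by
    rw [← Complex.ofReal_mul, Real.mul_self_sqrt (schurCoeff_nonneg q.2.1 n)]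
  simp only [schurVec_apply q hz, schurVec_apply q hw, RCLike.inner_apply, map_mul, map_pow,
    Complex.conj_conj, Complex.conj_ofReal]
  rw [← h]
  ring

/-- The row-valued Schur function `b(z) = (√(schurCoeff q n) z ^ (n + 1))_n`, as the functional
`⟪schurVec q z, ·⟫` on `ℓ²`. -/
noncomputable def schurFun (q : unitInterval) (z : ℂ) : ℓ²(ℕ, ℂ) →L[ℂ] ℂ :=
  innerSL ℂ (schurVec q z)

/-- On the diagonal, `inner_schurVec` gives `‖b(z)‖² = 1 - (1 - |z|²) E_q(|z|²)`, and
`E_q(|z|²) ≥ 0`. -/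
theorem norm_schurFun_le_one (q : unitInterval) {z : ℂ} (hz : ‖z‖ < 1) :
    ‖schurFun q z‖ ≤ 1 := by
  have h := inner_schurVec q hz hz
  have hx : z * conj z = ((‖z‖ ^ 2 : ℝ) : ℂ) := by
    rw [Complex.mul_conj, Complex.normSq_eq_norm_sq]
  have hE : qExp q (((‖z‖ ^ 2 : ℝ) : ℂ)) =
      ((∑' n : ℕ, (‖z‖ ^ 2) ^ n / qFactorial q n : ℝ) : ℂ) := by
    rw [qExp, Complex.ofReal_tsum]
    push_cast
    rfl
  have hpos : 0 ≤ ∑' n : ℕ, (‖z‖ ^ 2) ^ n / qFactorial q n :=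
    tsum_nonneg fun n ↦ div_nonneg (by positivity) (qFactorial_pos q.2.1 n).le
  rw [hx, hE, inner_self_eq_norm_sq_to_K] at h
  have h' : ‖schurVec q z‖ ^ 2 =
      1 - (1 - ‖z‖ ^ 2) * ∑' n : ℕ, (‖z‖ ^ 2) ^ n / qFactorial q n := by
    rw [← Complex.ofReal_inj]
    exact (by simpa using h)
  have hz2 : ‖z‖ ^ 2 < 1 := pow_lt_one₀ (norm_nonneg z) hz two_ne_zero
  rw [schurFun, innerSL_apply_norm, ← sq_le_one_iff₀ (norm_nonneg _), h']
  nlinarith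

/-- The power series of `b` in the dual of `ℓ²`. The embedding `innerSL` is conjugate-linear and so
turns the powers of `conj z` in `schurVec` into powers of `z`. -/
theorem hasSum_schurFun (q : unitInterval) {z : ℂ} (hz : ‖z‖ < 1) :
    HasSum (fun n ↦ z ^ (n + 1) •
      innerSL ℂ (lp.single (E := fun _ : ℕ ↦ ℂ) 2 n (√(schurCoeff q n) : ℂ)))
      (schurFun q z) := by
  have h := (lp.hasSum_single (by simp) (schurVec q z)).mapL (innerSL ℂ)
  refine Eq.subst (motive := (HasSum · _)) (funext fun n ↦ ?_) h
  rw [schurVec_apply q hz, mul_comm, ← smul_eq_mul, lp.single_smul, map_smulₛₗ]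
  simp

theorem isSchurFunction_schurFun (q : unitInterval) : IsSchurFunction (schurFun q) where
  norm_le_one z hz := norm_schurFun_le_one q (by simpa using hz)
  differentiableOn := by
    intro z hz
    obtain ⟨r, hzr, hr⟩ := exists_between (mem_ball_zero_iff.1 hz)
    have hr0 : 0 ≤ r := (norm_nonneg z).trans hzr.le
    have hd : DifferentiableOn ℂ (fun z : ℂ ↦ ∑' n, z ^ (n + 1) •
        innerSL ℂ (lp.single (E := fun _ : ℕ ↦ ℂ) 2 n (√(schurCoeff q n) : ℂ)))
        (Metric.ball 0 r) := by
      refine Complex.differentiableOn_tsum_of_summable_norm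
        ((summable_geometric_of_lt_one hr0 hr).mul_left r) (fun n ↦ ?_) Metric.isOpen_ball
        fun n w hw ↦ ?_
      · exact ((differentiable_id.pow (n + 1)).smul_const _).differentiableOn
      · have hw' : ‖w‖ ≤ r := (mem_ball_zero_iff.1 hw).le
        have hc : √(schurCoeff q n) ≤ 1 := Real.sqrt_le_one.2 (schurCoeff_le_one q.2.1 n)
        rw [norm_smul, innerSL_apply_norm, lp.norm_single (by simp), norm_pow,
          Complex.norm_real, Real.norm_of_nonneg (Real.sqrt_nonneg _), ← pow_succ']
        calc ‖w‖ ^ (n + 1) * √(schurCoeff q n) ≤ r ^ (n + 1) * 1 := by gcongr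
          _ = r ^ (n + 1) := mul_one _
    refine DifferentiableAt.differentiableWithinAt ?_
    refine (hd.congr fun w hw ↦ ?_).differentiableAt
      (Metric.isOpen_ball.mem_nhds (by simpa using hzr))
    exact (hasSum_schurFun q ((mem_ball_zero_iff.1 hw).trans hr)).tsum_eq.symm

theorem dBRKernel_schurFun (q : unitInterval) {z w : ℂ} (hz : ‖z‖ < 1) (hw : ‖w‖ < 1) :
    dBRKernel (schurFun q) z w = qExp q (z * conj w) • ContinuousLinearMap.id ℂ ℂ := by
  have hne : 1 - z * conj w ≠ 0 := by
    have ht : ‖z * conj w‖ < 1 := by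
      rw [norm_mul, RCLike.norm_conj]
      exact mul_lt_one_of_nonneg_of_lt_one_left (norm_nonneg z) hz hw.le
    intro h
    rw [← sub_eq_zero.1 h] at ht
    simp at ht
  ext
  simp only [dBRKernel, schurFun, ContinuousLinearMap.adjoint_innerSL_apply,
    smul_apply, sub_apply, ContinuousLinearMap.id_apply,
    ContinuousLinearMap.comp_apply, ContinuousLinearMap.toSpanSingleton_apply, one_smul,
    innerSL_apply_apply, inner_schurVec q hz hw, smul_eq_mul]
  field_simp
  ring

/-! ### Functions in the `q`-Fock space are analytic -/

/-- By `2 |z| |w| ≤ |z|² + |w|²`, the kernel is evaluated where the series of `E_q` converges. -/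
theorem norm_mul_lt_of_mem_qDisk {q : ℝ} (h1 : q ≤ 1) {z w : ℂ} (hz : z ∈ qDisk q)
    (hw : w ∈ qDisk q) : (1 - q) * ‖z * conj w‖ < 1 := by
  have hz' : (1 - q) * ‖z‖ ^ 2 < 1 := hz
  have hw' : (1 - q) * ‖w‖ ^ 2 < 1 := hw
  rw [norm_mul, RCLike.norm_conj]
  nlinarith [mul_nonneg (sub_nonneg.2 h1) (sq_nonneg (‖z‖ - ‖w‖))]

theorem isOpen_qDisk (q : ℝ) : IsOpen (qDisk q) :=
  isOpen_lt (by fun_prop) continuous_const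

theorem isPreconnected_qDisk {q : ℝ} (h1 : q ≤ 1) : IsPreconnected (qDisk q) := by
  refine (StarConvex.isPathConnected (a := (0 : ℂ)) ?_
    (by simp [qDisk])).isConnected.isPreconnected
  refine starConvex_zero_iff.2 fun z hz a ha0 ha1 ↦ ?_
  have hz' : (1 - q) * ‖z‖ ^ 2 < 1 := hz
  change (1 - q) * ‖a • z‖ ^ 2 < 1
  refine lt_of_le_of_lt ?_ hz'
  have h : ‖a • z‖ ≤ ‖z‖ := by
    rw [norm_smul, Real.norm_of_nonneg ha0]
    exact mul_le_of_le_one_left (norm_nonneg z) ha1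
  have := sub_nonneg.2 h1
  gcongr

theorem kerFun_H2_apply (q : unitInterval) (w : qDisk q) (v : ℂ) (z : qDisk q) :
    RKHS.kerFun (H2 q) w v z = qExp q ((z : ℂ) * conj (w : ℂ)) * v := by
  rw [RKHS.kerFun_apply, RKHS.OfKernel.kernel_ofKernel]
  simp [qKernel]

theorem norm_kerFun_H2 (q : unitInterval) (z : qDisk q) :
    ‖RKHS.kerFun (H2 q) z‖ = √‖qExp q ((z : ℂ) * conj (z : ℂ))‖ := by
  rw [RKHS.norm_kerFun_eq_sqrt_norm_kernel, RKHS.OfKernel.kernel_ofKernel]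
  simp [qKernel, norm_smul]

/-- The extension of `f` by `0` to the whole plane, so that differentiability over `ℂ` can be
stated. -/
noncomputable def extendZero {q : unitInterval} (f : H2 q) : ℂ → ℂ :=
  Function.extend Subtype.val f 0

theorem extendZero_apply {q : unitInterval} (f : H2 q) (z : qDisk q) :
    extendZero f z = f z := Subtype.val_injective.extend_apply _ _ _

theorem differentiableOn_extendZero {q : unitInterval} (f : H2 q) :
    DifferentiableOn ℂ (extendZero f) (qDisk q) := by
  have hf : f ∈ closure
      (Submodule.span ℂ {RKHS.kerFun (H2 q) x v | (x) (v)} : Set (H2 q)) := by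
    rw [← Submodule.topologicalClosure_coe, RKHS.kerFun_dense]
    trivial
  obtain ⟨F, hF, hlim⟩ := mem_closure_iff_seq_limit.1 hf
  refine TendstoLocallyUniformlyOn.differentiableOn (F := fun n ↦ extendZero (F n))
    (φ := Filter.atTop) ?_ (Filter.Eventually.of_forall fun n ↦ ?_) (isOpen_qDisk q)
  · -- `‖K_z‖² = E_q(|z|²)` is continuous in `z`, hence bounded on compact sets.
    rw [tendstoLocallyUniformlyOn_iff_forall_isCompact (isOpen_qDisk q)]
    intro K hKD hK
    have hcont : ContinuousOn (fun z : ℂ ↦ √‖qExp q (z * conj z)‖) K := by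
      intro z hz
      have := (differentiableAt_qExp q.2.1 q.2.2
        (norm_mul_lt_of_mem_qDisk q.2.2 (hKD hz) (hKD hz))).continuousAt
      refine (Real.continuous_sqrt.continuousAt.comp (ContinuousAt.norm
        (ContinuousAt.comp (f := fun z : ℂ ↦ z * conj z) this ?_))).continuousWithinAt
      fun_prop
    obtain ⟨C, hC⟩ := hK.bddAbove_image hcont
    have hu := RKHS.tendstoUniformlyOn_of_norm_kerFun_le (H := H2 q)
      (s := Subtype.val ⁻¹' K) (C := C) (fun x hx ↦ by
        rw [norm_kerFun_H2]
        exact hC ⟨x, hx, rfl⟩) hlim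
    intro u hu'
    filter_upwards [hu u hu'] with n hn z hz
    have := hn ⟨z, hKD hz⟩ hz
    rwa [← extendZero_apply, ← extendZero_apply] at this
  · refine Submodule.span_induction
      (p := fun g _ ↦ DifferentiableOn ℂ (extendZero g) (qDisk q)) ?_ ?_ ?_ ?_ (hF n)
    · rintro _ ⟨w, v, rfl⟩
      have hd : DifferentiableOn ℂ (fun z ↦ qExp q (z * conj (w : ℂ)) * v) (qDisk q) := by
        intro z hz
        refine DifferentiableAt.differentiableWithinAt (DifferentiableAt.mul_const ?_ v)
        exact DifferentiableAt.comp z (differentiableAt_qExp q.2.1 q.2.2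
          (norm_mul_lt_of_mem_qDisk q.2.2 hz w.2)) (by fun_prop)
      refine hd.congr fun z hz ↦ ?_
      rw [extendZero_apply _ ⟨z, hz⟩, kerFun_H2_apply]
    · refine (differentiableOn_const 0).congr fun z hz ↦ ?_
      rw [extendZero_apply _ ⟨z, hz⟩, RKHS.coe_zero, Pi.zero_apply]
    · intro g h _ _ hg hh
      refine (hg.add hh).congr fun z hz ↦ ?_
      simp only [Pi.add_apply, extendZero_apply _ ⟨z, hz⟩, RKHS.coe_add]
    · intro a g _ hg
      refine (hg.const_smul a).congr fun z hz ↦ ?_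
      simp only [Pi.smul_apply, extendZero_apply _ ⟨z, hz⟩, RKHS.coe_smul]

/-- Restriction to the unit disk is injective on `H2 q`. -/
theorem eq_zero_of_eqOn_ball {q : unitInterval} {f : H2 q}
    (hf : ∀ z : Metric.ball (0 : ℂ) 1, f ⟨z, ball_subset_qDisk q z.2⟩ = 0) : f = 0 := by
  have han : AnalyticOnNhd ℂ (extendZero f) (qDisk q) :=
    (differentiableOn_extendZero f).analyticOnNhd (isOpen_qDisk q)
  have h0 : (0 : ℂ) ∈ Metric.ball (0 : ℂ) 1 := by simp
  have hev : extendZero f =ᶠ[nhds 0] 0 := by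
    filter_upwards [Metric.isOpen_ball.mem_nhds h0] with z hz
    rw [extendZero_apply f ⟨z, ball_subset_qDisk q hz⟩]
    exact hf ⟨z, hz⟩
  have heq := han.eqOn_zero_of_preconnected_of_eventuallyEq_zero (isPreconnected_qDisk q.2.2)
    (ball_subset_qDisk q h0) hev
  refine RKHS.ext fun z ↦ ?_
  rw [← extendZero_apply, heq z.2, RKHS.coe_zero, Pi.zero_apply, Pi.zero_apply]

/-! ### Restriction to the unit disk -/

/-- The Hilbert space `H2 q`, its elements being regarded as functions on the unit disk by
restriction. No element is lost by `eq_zero_of_eqOn_ball`. -/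
@[reducible]
noncomputable def restrictBall (q : unitInterval) : RKHS ℂ (H2 q) (Metric.ball (0 : ℂ) 1) ℂ where
  coeCLM := .pi fun z ↦ (ContinuousLinearMap.proj (R := ℂ) (φ := fun _ : qDisk q ↦ ℂ)
    ⟨z, ball_subset_qDisk q z.2⟩).comp (RKHS.coeCLM ℂ)
  coeCLM_injective := (injective_iff_map_eq_zero _).mpr fun _ h ↦
    eq_zero_of_eqOn_ball fun z ↦ congrFun h z

/-- Evaluation at a point of the unit disk is the same functional in both structures, and the kernel
is built from these functionals and their adjoints. -/
theorem kernel_restrictBall (q : unitInterval) (z w : Metric.ball (0 : ℂ) 1) :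
    @RKHS.kernel _ _ _ _ _ _ (H2 q) _ _ (restrictBall q) _ _ z w =
      RKHS.kernel (H2 q) ⟨z, ball_subset_qDisk q z.2⟩ ⟨w, ball_subset_qDisk q w.2⟩ := rfl

theorem kernel_H2_eq_dBRKernel (q : unitInterval) {z w : ℂ} (hz : z ∈ Metric.ball (0 : ℂ) 1)
    (hw : w ∈ Metric.ball (0 : ℂ) 1) :
    RKHS.kernel (H2 q) ⟨z, ball_subset_qDisk q hz⟩ ⟨w, ball_subset_qDisk q hw⟩ =
      dBRKernel (schurFun q) z w := by
  rw [RKHS.OfKernel.kernel_ofKernel, dBRKernel_schurFun q (mem_ball_zero_iff.1 hz)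
    (mem_ball_zero_iff.1 hw)]
  rfl

end QFock

theorem mainTheorem8 (q : unitInterval) :
    ∃ b : ℂ → ℓ²(ℕ, ℂ) →L[ℂ] ℂ,
      -- the kernel of `H_{2,q}` has the de Branges–Rovnyak form on the unit disk
      QFock.IsSchurFunction b ∧
      (∀ (z w : ℂ) (hz : z ∈ Metric.ball (0 : ℂ) 1) (hw : w ∈ Metric.ball (0 : ℂ) 1),
        RKHS.kernel (QFock.H2 q) ⟨z, QFock.ball_subset_qDisk q hz⟩
          ⟨w, QFock.ball_subset_qDisk q hw⟩ = QFock.dBRKernel b z w) ∧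
      -- restriction to the unit disk maps `H_{2,q}` isometrically onto the space `H(b)`
      ∃ (Hb : Type) (_ : NormedAddCommGroup Hb) (_ : InnerProductSpace ℂ Hb)
        (_ : CompleteSpace Hb) (_ : RKHS ℂ Hb (Metric.ball (0 : ℂ) 1) ℂ),
        QFock.IsDeBrangesRovnyakSpace b Hb ∧
        ∃ Φ : QFock.H2 q ≃ₗᵢ[ℂ] Hb, ∀ (f : QFock.H2 q) (z : Metric.ball (0 : ℂ) 1),
          Φ f z = f ⟨z, QFock.ball_subset_qDisk q z.2⟩ := by
  refine ⟨QFock.schurFun q, QFock.isSchurFunction_schurFun q,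
    fun z w hz hw ↦ QFock.kernel_H2_eq_dBRKernel q hz hw,
    QFock.H2 q, inferInstance, inferInstance, inferInstance, QFock.restrictBall q, ?_, ?_⟩
  · exact @QFock.IsDeBrangesRovnyakSpace.mk _ _ _ _ _ _ _ _ _ _ _ _ _ (QFock.restrictBall q)
      (QFock.isSchurFunction_schurFun q) fun z w ↦
        (QFock.kernel_restrictBall q z w).trans (QFock.kernel_H2_eq_dBRKernel q z.2 w.2)
  · -- Restriction is already built into the evaluations of `restrictBall`, so the identity of the
    -- Hilbert space is the restriction map.
    exact ⟨LinearIsometryEquiv.refl ℂ _, fun _ _ ↦ rfl⟩
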